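/- Let $(\lambda_i)_{i\ge 1}$ be nonnegative reals with $\lambda_i<\lambda_{\max}$ for all $i$, for some $\lambda_{\max}<\infty$, and $\lim_{n\to\infty}\frac{\lambda_1+\dots+\lambda_n}{n}=\bar\lambda$. For each $n\ge 1$ let $v^{(n)}\sim\mathcal{CN}(0,\operatorname{diag}(\lambda_1,\dots,\lambda_n))$ be a circularly symmetric complex normal vector (its coordinates are independent, and the real and imaginary parts of the $i$-th one are independent $N(0,\lambda_i/2)$), and let $\omega_n$ be a uniformly chosen eigenvalue of the dyad $v^{(n)}(v^{(n)})^H$: the $n$ eigenvalues are listed with multiplicity, and the chosen position is uniform and independent of $v^{(n)}$. Then $$\lim_{n\to\infty}\mathcal R_{\omega_n}\!\left(\frac sn\right)=\frac{\bar\lambda}{1-s\bar\lambda}$$ for the $\mathcal R$-transform in each of the following two senses. (a) Cumulant series. For every $n$ the moment generating function of $\omega_n$ is finite in a neighbourhood of $0$. Put $\mathcal R_X(s)=\sum_{k\ge 0}\kappa_{k+1}(X)\,s^k$, a formal power series in $s$, where $\kappa_k(X)=\frac{d^k}{ds^k}\log\mathbb E[e^{sX}]\big|_{s=0}$. The limit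 holds coefficientwise in the formal power series in $s$, that is, $\lim_{n\to\infty}\kappa_{k+1}(\omega_n)/n^k=\bar\lambda^{k+1}$ for every $k\ge 0$. (b) Inverse Stieltjes transform. Put $G_X(z)=\mathbb E\left[\frac1{X-z}\right]$ for $z<0$, and $\mathcal R_X(s)=G_X^{-1}(-s)-\frac1s$ for $s<0$. For all sufficiently large $n$, $G_{\omega_n}$ is a bijection from $(-\infty,0)$ onto $(0,\infty)$, so that $\mathcal R_{\omega_n}(s)$ is well defined for all $s<0$; and the limit holds for every real $s<0$. -/

import Mathlib

open MeasureTheory ProbabilityTheory Filter Topology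
open scoped NNReal ENNReal PowerSeries PowerSeries.WithPiTopology

noncomputable section

/-- The circularly symmetric complex normal law `CN(0, c)` on `ℂ`: real and imaginary parts are
independent centred real normals of variance `c / 2` each (so `E|z|^2 = c`). -/
def complexNormal (c : ℝ≥0) : Measure ℂ :=
  ((gaussianReal 0 (c / 2)).prod (gaussianReal 0 (c / 2))).map
    (fun p : ℝ × ℝ => (⟨p.1, p.2⟩ : ℂ))

/-- The complex normal law `CN(0, diag(c_1, …, c_n))` on `ℂ^n`: the coordinates are independent,
the `i`-th one with law `CN(0, c_i)`. -/
def complexNormalDiag {n : ℕ} (c : Fin n → ℝ≥0) : Measure (Fin n → ℂ) :=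
  Measure.pi fun i => complexNormal (c i)

/-- The dyad `v vᴴ`. -/
def dyad {n : ℕ} (v : Fin n → ℂ) : Matrix (Fin n) (Fin n) ℂ :=
  Matrix.vecMulVec v (star v)

theorem dyad_isHermitian {n : ℕ} (v : Fin n → ℂ) : (dyad v).IsHermitian := by
  ext i j
  simp [dyad, Matrix.vecMulVec_apply, Matrix.conjTranspose_apply, mul_comm]

/-- The eigenvalue of the dyad `v vᴴ` (eigenvalues listed with multiplicity) at the random
position `J`. -/
def selectedEigenvalue {Ω : Type*} {n : ℕ} (v : Ω → Fin n → ℂ) (J : Ω → Fin n) (x : Ω) : ℝ :=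
  (dyad_isHermitian (v x)).eigenvalues (J x)

section Transforms

variable {Ω : Type*} [MeasurableSpace Ω]

/-- The `k`-th cumulant: the `k`-th derivative at `0` of `s ↦ log E[exp (s X)]`. -/
def cumulant (X : Ω → ℝ) (P : Measure Ω) (k : ℕ) : ℝ :=
  iteratedDeriv k (cgf X P) 0

/-- The R-transform as the cumulant series `∑ k, κ_{k+1} s^k`, a formal power series in `s`. -/
def rSeries (X : Ω → ℝ) (P : Measure Ω) : ℝ⟦X⟧ :=
  PowerSeries.mk fun k => cumulant X P (k + 1)

/-- The Stieltjes transform `G_X(z) = E[1 / (X - z)]`. -/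
def stieltjes (X : Ω → ℝ) (P : Measure Ω) (z : ℝ) : ℝ :=
  ∫ x, 1 / (X x - z) ∂P

/-- The inverse function of the Stieltjes transform of a nonnegative random variable on the half
line `(-∞, 0)`, to the left of the support. -/
def stieltjesInv (X : Ω → ℝ) (P : Measure Ω) : ℝ → ℝ :=
  Function.invFunOn (stieltjes X P) (Set.Iio 0)

/-- The R-transform through the inverse of the Stieltjes transform:
`R_X(s) = G_X⁻¹(-s) - 1 / s`. -/
def rTransform (X : Ω → ℝ) (P : Measure Ω) (s : ℝ) : ℝ :=
  stieltjesInv X P (-s) - 1 / s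

end Transforms

end

/-! Write `N = n + 1` for the dimension. A dyad has rank at most one, so its spectrum is its trace,
the energy `‖v‖²`, together with zeros. A uniformly chosen eigenvalue `ω` therefore has law `1/N`
times the law of the energy plus `1 - 1/N` times the Dirac mass at `0`
(`integral_comp_selectedEigenvalue`). The normalised energy `W = ‖v‖²/N` has mean tending to
`lamBar` and, as the variances are bounded, variance `O(1/N)`; so `W → lamBar` in `L²`, and all its
moments converge too.

Cumulants: `E[ω^(k+1)] / N^k = E[W^(k+1)] → lamBar^(k+1)`. In the recursion of `cumulant_succ` each
product of a moment and a lower cumulant is only `O(N^(k-1))`, so after division by `N^k` cumulants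
and moments have the same limit.

Stieltjes: for `s = -t`, put the preimage of `t/N` at `z = -N y`. The mixture turns `G(z) = t/N`
into `N (1 - t y) = 1 - y I` with `I = E[1/(W + y)]`. The R-transform is then exactly `(1 - y I)/t`.
Since `0 ≤ y I ≤ 1`, the relation forces `y → 1/t`, hence `I → 1/(lamBar + 1/t)` and the limit is
`lamBar/(1 + t lamBar)`. -/

noncomputable section

/-! ### Spectrum of a dyad -/

section DyadSpectrum

open scoped ComplexOrder

theorem trace_dyad {n : ℕ} (v : Fin n → ℂ) :
    (dyad v).trace = ((∑ i, Complex.normSq (v i) : ℝ) : ℂ) := by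
  simp [dyad, Matrix.trace, Matrix.vecMulVec_apply, Complex.mul_conj]

theorem sum_eigenvalues_dyad {n : ℕ} (v : Fin n → ℂ) :
    ∑ i, (dyad_isHermitian v).eigenvalues i = ∑ i, Complex.normSq (v i) := by
  have h := (dyad_isHermitian v).trace_eq_sum_eigenvalues
  rw [trace_dyad] at h
  rw [← Complex.ofReal_inj, h]
  simp

theorem eigenvalues_dyad_nonneg {n : ℕ} (v : Fin n → ℂ) (i : Fin n) :
    0 ≤ (dyad_isHermitian v).eigenvalues i :=
  (show (dyad v).PosSemidef from Matrix.posSemidef_vecMulVec_self_star v).eigenvalues_nonneg i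

theorem eq_of_eigenvalues_dyad_ne_zero {n : ℕ} (v : Fin n → ℂ) {i j : Fin n}
    (hi : (dyad_isHermitian v).eigenvalues i ≠ 0) (hj : (dyad_isHermitian v).eigenvalues j ≠ 0) :
    i = j := by
  have h : (dyad v).rank ≤ 1 := Matrix.rank_vecMulVec_le v (star v)
  rw [(dyad_isHermitian v).rank_eq_card_non_zero_eigs, Fintype.card_le_one_iff] at h
  exact congrArg Subtype.val (h ⟨i, hi⟩ ⟨j, hj⟩)

/-- The position of the largest eigenvalue in Mathlib's list of the eigenvalues of a Hermitian
matrix. -/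
def topIndex (n : ℕ) : Fin (n + 1) :=
  (Fintype.equivOfCardEq (Fintype.card_fin _)) (⟨0, by simp⟩ : Fin (Fintype.card (Fin (n + 1))))

theorem eigenvalues_le_topIndex {n : ℕ} {A : Matrix (Fin (n + 1)) (Fin (n + 1)) ℂ}
    (hA : A.IsHermitian) (i : Fin (n + 1)) : hA.eigenvalues i ≤ hA.eigenvalues (topIndex n) := by
  simp only [Matrix.IsHermitian.eigenvalues, topIndex, Equiv.symm_apply_apply]
  exact hA.eigenvalues₀_antitone (Fin.mk_le_of_le_val (Nat.zero_le _))

/-- A nonzero eigenvalue elsewhere would make the largest one nonzero as well, against rank one. The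
position `topIndex n` does not depend on `v`, so whether `J` hits it is independent of the vector.
-/
theorem eigenvalues_dyad {n : ℕ} (v : Fin (n + 1) → ℂ) (j : Fin (n + 1)) :
    (dyad_isHermitian v).eigenvalues j =
      if j = topIndex n then ∑ i, Complex.normSq (v i) else 0 := by
  have hz : ∀ j, j ≠ topIndex n → (dyad_isHermitian v).eigenvalues j = 0 := by
    intro j hj
    by_contra h
    refine hj (eq_of_eigenvalues_dyad_ne_zero v h ?_)
    exact (((eigenvalues_dyad_nonneg v j).lt_of_ne' h).trans_le
      (eigenvalues_le_topIndex _ j)).ne'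
  split_ifs with h
  · rw [← sum_eigenvalues_dyad, h, Finset.sum_eq_single _ (fun j _ hj => hz j hj) (by simp)]
  · exact hz j h

end DyadSpectrum

/-! ### Moments of the complex normal law -/

section ComplexNormal

theorem measurable_complex_mk : Measurable (fun p : ℝ × ℝ => (⟨p.1, p.2⟩ : ℂ)) :=
  Complex.measurableEquivRealProd.symm.measurable

theorem measurable_normSq : Measurable Complex.normSq :=
  Complex.continuous_normSq.measurable

instance (c : ℝ≥0) : IsProbabilityMeasure (complexNormal c) :=
  Measure.isProbabilityMeasure_map measurable_complex_mk.aemeasurable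

instance {n : ℕ} (c : Fin n → ℝ≥0) : IsProbabilityMeasure (complexNormalDiag c) := by
  unfold complexNormalDiag; infer_instance

/-- Fernique's theorem; it supplies all exponential integrability below. -/
theorem exists_integrable_exp_sq_gaussianReal (c : ℝ≥0) :
    ∃ t > 0, Integrable (fun x => Real.exp (t * x ^ 2)) (gaussianReal 0 c) := by
  simpa using IsGaussian.exists_integrable_exp_sq (gaussianReal 0 c)

theorem zero_mem_interior_integrableExpSet_of_nonneg {Ω : Type*} [MeasurableSpace Ω]
    {μ : Measure Ω} [IsFiniteMeasure μ] {X : Ω → ℝ} (hX : 0 ≤ X) (hm : AEMeasurable X μ)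
    {t : ℝ} (ht : 0 < t) (h : Integrable (fun x => Real.exp (t * X x)) μ) :
    0 ∈ interior (integrableExpSet X μ) := by
  rw [mem_interior_iff_mem_nhds]
  filter_upwards [Iio_mem_nhds ht] with s hs
  refine h.mono' ((hm.const_mul s).exp.aestronglyMeasurable) (ae_of_all _ fun x => ?_)
  rw [Real.norm_eq_abs, abs_of_pos (Real.exp_pos _)]
  exact Real.exp_le_exp.2 (mul_le_mul_of_nonneg_right (le_of_lt hs) (hX x))

theorem zero_mem_interior_integrableExpSet_normSq (c : ℝ≥0) :
    0 ∈ interior (integrableExpSet Complex.normSq (complexNormal c)) := by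
  obtain ⟨t, ht, h⟩ := exists_integrable_exp_sq_gaussianReal (c / 2)
  refine zero_mem_interior_integrableExpSet_of_nonneg Complex.normSq_nonneg
    measurable_normSq.aemeasurable ht ?_
  rw [complexNormal, integrable_map_measure
    (by exact (measurable_normSq.const_mul t).exp.aestronglyMeasurable)
    measurable_complex_mk.aemeasurable]
  refine (h.mul_prod h).congr (ae_of_all _ fun p => ?_)
  simp only [Function.comp, Complex.normSq_mk, ← Real.exp_add]
  ring_nf

/-- Scaling reduces every moment to the case `c = 1`, which gives bounds uniform over the
coordinates. -/
theorem complexNormal_eq_map (c : ℝ≥0) :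
    complexNormal c = (complexNormal 1).map (fun z => ((Real.sqrt c : ℝ) : ℂ) * z) := by
  have h : gaussianReal 0 (c / 2) = (gaussianReal 0 (1 / 2)).map (Real.sqrt c * ·) := by
    rw [gaussianReal_map_const_mul]
    congr 1
    · simp
    · ext
      simp [div_eq_mul_inv]
  rw [complexNormal, complexNormal, h, Measure.map_prod_map _ _ (by fun_prop) (by fun_prop),
    Measure.map_map measurable_complex_mk (by fun_prop),
    Measure.map_map (by fun_prop) measurable_complex_mk]
  congr 1
  ext p : 1
  apply Complex.ext <;> simp

theorem integral_normSq_pow_complexNormal (c : ℝ≥0) (k : ℕ) :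
    ∫ z, Complex.normSq z ^ k ∂(complexNormal c) =
      (c : ℝ) ^ k * ∫ z, Complex.normSq z ^ k ∂(complexNormal 1) := by
  rw [complexNormal_eq_map, integral_map (by fun_prop)
    (by exact (measurable_normSq.pow_const k).aestronglyMeasurable), ← integral_const_mul]
  simp [mul_pow, Complex.normSq_ofReal]

theorem integral_sq_gaussianReal_zero (c : ℝ≥0) : ∫ x, x ^ 2 ∂(gaussianReal 0 c) = c := by
  have h := variance_fun_id_gaussianReal (μ := 0) (v := c)
  rwa [variance_eq_integral (by fun_prop), integral_id_gaussianReal, integral_congr_ae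
    (g := fun x => x ^ 2) (ae_of_all _ fun x => by simp)] at h

theorem integrable_sq_gaussianReal (c : ℝ≥0) :
    Integrable (fun x : ℝ => x ^ 2) (gaussianReal 0 c) :=
  (memLp_id_gaussianReal (μ := 0) (v := c) 2).integrable_sq

theorem integral_normSq_complexNormal (c : ℝ≥0) :
    ∫ z, Complex.normSq z ∂(complexNormal c) = c := by
  rw [complexNormal, integral_map measurable_complex_mk.aemeasurable
    measurable_normSq.aestronglyMeasurable]
  have h := integrable_sq_gaussianReal (c / 2)
  have e : ∀ p : ℝ × ℝ, Complex.normSq ⟨p.1, p.2⟩ = p.1 ^ 2 + p.2 ^ 2 := fun p => by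
    rw [Complex.normSq_mk]; ring
  simp only [e]
  rw [integral_add (h.comp_fst _) (h.comp_snd _), integral_fun_fst (fun x : ℝ => x ^ 2),
    integral_fun_snd (fun x : ℝ => x ^ 2)]
  simp [integral_sq_gaussianReal_zero]

theorem integrable_normSq_pow_complexNormal (c : ℝ≥0) (k : ℕ) :
    Integrable (fun z => Complex.normSq z ^ k) (complexNormal c) :=
  integrable_pow_of_mem_interior_integrableExpSet (zero_mem_interior_integrableExpSet_normSq c) k

theorem memLp_normSq_complexNormal (c : ℝ≥0) (p : ℝ≥0) :
    MemLp Complex.normSq p (complexNormal c) :=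
  memLp_of_mem_interior_integrableExpSet (zero_mem_interior_integrableExpSet_normSq c) p

theorem variance_normSq_complexNormal (c : ℝ≥0) :
    Var[Complex.normSq; complexNormal c] =
      (c : ℝ) ^ 2 * Var[Complex.normSq; complexNormal 1] := by
  rw [variance_eq_sub (memLp_normSq_complexNormal c 2),
    variance_eq_sub (memLp_normSq_complexNormal 1 2)]
  simp only [Pi.pow_apply, integral_normSq_complexNormal]
  rw [integral_normSq_pow_complexNormal]
  simp
  ring

end ComplexNormal

/-! ### Moments of the squared norm -/

section Energy

/-- The squared Euclidean norm of a complex vector. -/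
def energy {n : ℕ} (z : Fin n → ℂ) : ℝ := ∑ i, Complex.normSq (z i)

theorem energy_nonneg {n : ℕ} (z : Fin n → ℂ) : 0 ≤ energy z :=
  Finset.sum_nonneg fun i _ => Complex.normSq_nonneg (z i)

theorem measurable_energy {n : ℕ} : Measurable (energy : (Fin n → ℂ) → ℝ) :=
  Finset.measurable_sum _ fun i _ => measurable_normSq.comp (measurable_pi_apply i)

variable {n : ℕ} (c : Fin n → ℝ≥0)

theorem measurePreserving_eval_complexNormalDiag (i : Fin n) :
    MeasurePreserving (Function.eval i) (complexNormalDiag c) (complexNormal (c i)) :=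
  measurePreserving_eval _ i

theorem zero_mem_interior_integrableExpSet_energy :
    0 ∈ interior (integrableExpSet (energy : (Fin n → ℂ) → ℝ) (complexNormalDiag c)) := by
  have hind : iIndepFun (fun (i : Fin n) (z : Fin n → ℂ) => Complex.normSq (z i))
      (complexNormalDiag c) :=
    iIndepFun_pi (μ := fun i => complexNormal (c i)) fun _ => measurable_normSq.aemeasurable
  have h : ∀ᶠ t in 𝓝 (0 : ℝ), ∀ i, t ∈ integrableExpSet Complex.normSq (complexNormal (c i)) :=
    eventually_all.2 fun i =>
      mem_interior_iff_mem_nhds.1 (zero_mem_interior_integrableExpSet_normSq (c i))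
  rw [mem_interior_iff_mem_nhds]
  filter_upwards [h] with t ht
  have := hind.integrable_exp_mul_sum (t := t) (s := Finset.univ)
    (fun i => measurable_normSq.comp (measurable_pi_apply i))
    (fun i _ => (measurePreserving_eval_complexNormalDiag c i).integrable_comp_of_integrable
      (ht i))
  simpa [integrableExpSet, energy] using this

theorem integrable_energy_pow (k : ℕ) :
    Integrable (fun z => energy z ^ k) (complexNormalDiag c) :=
  integrable_pow_of_mem_interior_integrableExpSet (zero_mem_interior_integrableExpSet_energy c) k

theorem memLp_energy (p : ℝ≥0) : MemLp energy p (complexNormalDiag c) :=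
  memLp_of_mem_interior_integrableExpSet (zero_mem_interior_integrableExpSet_energy c) p

theorem integral_eval_complexNormalDiag {f : ℂ → ℝ} (hf : Measurable f) (i : Fin n) :
    ∫ z, f (z i) ∂(complexNormalDiag c) = ∫ w, f w ∂(complexNormal (c i)) := by
  rw [← (measurePreserving_eval_complexNormalDiag c i).map_eq,
    integral_map (measurable_pi_apply i).aemeasurable hf.aestronglyMeasurable]

theorem integral_energy : ∫ z, energy z ∂(complexNormalDiag c) = ∑ i, (c i : ℝ) := by
  unfold energy
  rw [integral_finsetSum (f := fun i (z : Fin n → ℂ) => Complex.normSq (z i)) _ fun i _ =>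
    (measurePreserving_eval_complexNormalDiag c i).integrable_comp_of_integrable
      ((memLp_normSq_complexNormal (c i) 1).integrable le_rfl)]
  exact Finset.sum_congr rfl fun i _ => by
    rw [integral_eval_complexNormalDiag c measurable_normSq, integral_normSq_complexNormal]

theorem variance_energy :
    Var[energy; complexNormalDiag c] =
      (∑ i, (c i : ℝ) ^ 2) * Var[Complex.normSq; complexNormal 1] := by
  have h := variance_sum_pi (μ := fun i => complexNormal (c i))
    (X := fun _ => Complex.normSq) fun i => memLp_normSq_complexNormal (c i) 2
  rw [Finset.sum_mul, ← Finset.sum_congr rfl fun i _ => variance_normSq_complexNormal (c i), ← h]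
  refine congrArg (Var[·; complexNormalDiag c]) ?_
  ext z
  simp [energy]

/-- Power mean inequality, then scaling. The remaining moment is free of `n` and `c`, so the moments
of the energy divided by `n` are uniformly bounded. -/
theorem integral_energy_pow_succ_le {b : ℝ} (hb : ∀ i, (c i : ℝ) ≤ b) (k : ℕ) :
    ∫ z, energy z ^ (k + 1) ∂(complexNormalDiag c) ≤
      (n * b) ^ (k + 1) * ∫ z, Complex.normSq z ^ (k + 1) ∂(complexNormal 1) := by
  set M := ∫ z, Complex.normSq z ^ (k + 1) ∂(complexNormal 1)
  have hM : 0 ≤ M := integral_nonneg fun z => pow_nonneg (Complex.normSq_nonneg z) _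
  have hi : ∀ i, Integrable (fun z : Fin n → ℂ => Complex.normSq (z i) ^ (k + 1))
      (complexNormalDiag c) := fun i =>
    (measurePreserving_eval_complexNormalDiag c i).integrable_comp_of_integrable
      (integrable_normSq_pow_complexNormal (c i) (k + 1))
  calc ∫ z, energy z ^ (k + 1) ∂(complexNormalDiag c)
      ≤ ∫ z, (n : ℝ) ^ k * ∑ i, Complex.normSq (z i) ^ (k + 1) ∂(complexNormalDiag c) := by
        refine integral_mono (integrable_energy_pow c (k + 1))
          ((integrable_finsetSum _ fun i _ => hi i).const_mul _) fun z => ?_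
        rcases n.eq_zero_or_pos with rfl | hn
        · simp [energy]
        have h := pow_sum_div_card_le_sum_pow (s := Finset.univ)
          (f := fun i => Complex.normSq (z i)) (fun i _ => Complex.normSq_nonneg _) k
        rwa [div_le_iff₀' (by simpa using by positivity), Finset.card_univ, Fintype.card_fin] at h
    _ = (n : ℝ) ^ k * ∑ i, (c i : ℝ) ^ (k + 1) * M := by
        rw [integral_const_mul, integral_finsetSum _ fun i _ => hi i]
        congr 1
        exact Finset.sum_congr rfl fun i _ => by
          rw [integral_eval_complexNormalDiag c (measurable_normSq.pow_const (k + 1)),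
            integral_normSq_pow_complexNormal]
    _ ≤ (n : ℝ) ^ k * ∑ _i : Fin n, b ^ (k + 1) * M := by
        gcongr with i _
        exact hb i
    _ = (n * b) ^ (k + 1) * M := by
        simp
        ring

end Energy

/-! ### Law of the selected eigenvalue -/

section Mixture

theorem selectedEigenvalue_eq {Ω : Type*} {n : ℕ} (v : Ω → Fin (n + 1) → ℂ) (J : Ω → Fin (n + 1)) (x : Ω) :
    selectedEigenvalue v J x = if J x = topIndex n then energy (v x) else 0 :=
  eigenvalues_dyad (v x) (J x)

variable {Ω : Type*} [MeasurableSpace Ω] {P : Measure Ω}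

theorem measureReal_uniform_singleton {n : ℕ} {J : Ω → Fin (n + 1)}
    (hJ : HasLaw J (uniformOn Set.univ) P) (j : Fin (n + 1)) :
    P.real {x | J x = j} = 1 / ((n + 1 : ℕ) : ℝ) := by
  rw [hJ.measureReal_eq (p := fun i => i = j) (MeasurableSet.of_discrete), measureReal_def,
    uniformOn_univ]
  simp [ENNReal.toReal_add]

/-- The law of the selected eigenvalue of a dyad is the mixture of the law of the squared norm,
with weight `1 / (n + 1)`, and the Dirac mass at `0`. -/
theorem integral_comp_selectedEigenvalue [IsProbabilityMeasure P] {n : ℕ}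
    {v : Ω → Fin (n + 1) → ℂ} {J : Ω → Fin (n + 1)}
    (hJ : HasLaw J (uniformOn Set.univ) P) (hind : IndepFun v J P) {g : ℝ → ℝ} (hg : Measurable g)
    (hint : Integrable (fun x => g (energy (v x))) P) :
    Integrable (fun x => g (selectedEigenvalue v J x)) P ∧
      ∫ x, g (selectedEigenvalue v J x) ∂P =
        1 / ((n + 1 : ℕ) : ℝ) * ∫ x, g (energy (v x)) ∂P
          + (1 - 1 / ((n + 1 : ℕ) : ℝ)) * g 0 := by
  classical
  let ψ : Fin (n + 1) → ℝ := fun j => if j = topIndex n then 1 else 0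
  have hψ : Integrable (fun x => ψ (J x)) P :=
    Integrable.of_bound ((Measurable.of_discrete (f := ψ)).comp_aemeasurable
      hJ.aemeasurable).aestronglyMeasurable 1 (ae_of_all _ fun x => by
        simp only [ψ]; split_ifs <;> simp)
  have hψi : ∫ x, ψ (J x) ∂P = 1 / ((n + 1 : ℕ) : ℝ) := by
    rw [← measureReal_uniform_singleton hJ (topIndex n),
      hJ.measureReal_eq (p := fun i => i = topIndex n) MeasurableSet.of_discrete,
      show ∫ x, ψ (J x) ∂P = ∫ j, ψ j ∂(uniformOn Set.univ) from
        hJ.integral_comp (f := ψ) Measurable.of_discrete.aestronglyMeasurable, ← integral_indicator_one MeasurableSet.of_discrete]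
    refine integral_congr_ae (ae_of_all _ fun j => ?_)
    simp [ψ, Set.indicator_apply]
  have hφ : Integrable (fun x => g (energy (v x)) - g 0) P := hint.sub (integrable_const _)
  have hI : IndepFun (fun x => ψ (J x)) (fun x => g (energy (v x)) - g 0) P :=
    hind.symm.comp (φ := ψ) (ψ := fun z => g (energy z) - g 0) Measurable.of_discrete
      ((hg.comp measurable_energy).sub_const _)
  -- Subtracting `g 0` isolates a product of a function of `J` and a function of `v`, whose
  -- expectation factors.
  have e : (fun x => g (selectedEigenvalue v J x)) =
      fun x => ψ (J x) * (g (energy (v x)) - g 0) + g 0 := by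
    ext x
    rw [selectedEigenvalue_eq]
    simp only [ψ]
    split_ifs <;> simp
  have hprod : Integrable (fun x => ψ (J x) * (g (energy (v x)) - g 0)) P :=
    hI.integrable_mul hψ hφ
  rw [e]
  refine ⟨hprod.add (integrable_const _), ?_⟩
  rw [integral_add hprod (integrable_const _), hI.integral_fun_mul_eq_mul_integral
    hψ.aestronglyMeasurable hφ.aestronglyMeasurable, hψi, integral_sub hint (integrable_const _)]
  simp
  ring

theorem zero_mem_interior_integrableExpSet_selectedEigenvalue [IsProbabilityMeasure P] {n : ℕ} {c : Fin (n + 1) → ℝ≥0}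
    {v : Ω → Fin (n + 1) → ℂ} (hv : HasLaw v (complexNormalDiag c) P) {J : Ω → Fin (n + 1)}
    (hJ : HasLaw J (uniformOn Set.univ) P) (hind : IndepFun v J P) :
    0 ∈ interior (integrableExpSet (selectedEigenvalue v J) P) := by
  refine interior_mono (fun t ht => ?_) (zero_mem_interior_integrableExpSet_energy c)
  refine (integral_comp_selectedEigenvalue hJ hind (g := fun y => Real.exp (t * y))
    (by fun_prop) ?_).1
  refine Integrable.comp_aemeasurable (f := v) (g := fun z => Real.exp (t * energy z)) ?_
    hv.aemeasurable
  rw [hv.map_eq]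
  exact ht

end Mixture

/-! ### Concentration of the normalised energy -/

section Concentration

variable {Ω : Type*} [MeasurableSpace Ω] {P : Measure Ω}

theorem abs_integral_mul_le_sqrt {f g : Ω → ℝ} (hf : MemLp f 2 P) (hg : MemLp g 2 P) :
    |∫ x, f x * g x ∂P| ≤ √(∫ x, f x ^ 2 ∂P) * √(∫ x, g x ^ 2 ∂P) := by
  have h := integral_mul_norm_le_Lp_mul_Lq (μ := P) (f := f) (g := g) (p := 2) (q := 2)
    Real.HolderConjugate.two_two (by simpa using hf) (by simpa using hg)
  simp only [Real.rpow_ofNat, ← Real.sqrt_eq_rpow, Real.norm_eq_abs, sq_abs] at h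
  refine (abs_integral_le_integral_abs).trans ?_
  simpa only [abs_mul] using h

theorem integral_abs_le_sqrt [IsProbabilityMeasure P] {f : Ω → ℝ} (hf : MemLp f 2 P) :
    ∫ x, |f x| ∂P ≤ √(∫ x, f x ^ 2 ∂P) := by
  have h := abs_integral_mul_le_sqrt hf.abs (memLp_const (1 : ℝ))
  simp only [Pi.abs_apply, mul_one, sq_abs, one_pow, integral_const, probReal_univ, smul_eq_mul,
    Real.sqrt_one] at h
  exact (le_abs_self _).trans h

/-- Induction through `W^(k+1) = (W - a) W^k + a W^k`: by Cauchy–Schwarz the first term vanishes,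
the moments of order `2k` being bounded. -/
theorem tendsto_integral_pow_of_tendsto_sq [IsProbabilityMeasure P] {W : ℕ → Ω → ℝ} {a : ℝ}
    (hW : ∀ n k, MemLp (fun x => W n x ^ k) 2 P)
    (hb : ∀ k, ∃ C, ∀ n, ∫ x, W n x ^ k ∂P ≤ C)
    (h : Tendsto (fun n => ∫ x, (W n x - a) ^ 2 ∂P) atTop (𝓝 0)) (k : ℕ) :
    Tendsto (fun n => ∫ x, W n x ^ k ∂P) atTop (𝓝 (a ^ k)) := by
  induction k with
  | zero => simp
  | succ k ih =>
    have h1 : ∀ n, MemLp (fun x => W n x - a) 2 P := fun n =>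
      (by simpa using hW n 1 : MemLp (W n) 2 P).sub (memLp_const a)
    obtain ⟨C, hC⟩ := hb (2 * k)
    have hsq : Tendsto (fun n => √(∫ x, (W n x - a) ^ 2 ∂P) * √C) atTop (𝓝 0) := by
      simpa using h.sqrt.mul_const (√C)
    have h0 : Tendsto (fun n => ∫ x, (W n x - a) * W n x ^ k ∂P) atTop (𝓝 0) := by
      refine squeeze_zero_norm (fun n => ?_) hsq
      refine (abs_integral_mul_le_sqrt (h1 n) (hW n k)).trans ?_
      gcongr
      simpa only [← pow_mul, mul_comm k] using hC n
    have e : ∀ n, ∫ x, W n x ^ (k + 1) ∂P =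
        ∫ x, (W n x - a) * W n x ^ k ∂P + a * ∫ x, W n x ^ k ∂P := fun n => by
      rw [← integral_const_mul, ← integral_add]
      · exact integral_congr_ae (ae_of_all _ fun x => by ring)
      · exact (h1 n).integrable_mul (hW n k)
      · exact ((hW n k).integrable (by norm_num)).const_mul a
    simp only [e]
    simpa [pow_succ'] using h0.add (ih.const_mul a)

variable {lam : ℕ → ℝ≥0} {lamMax lamBar : ℝ}
  {v : (n : ℕ) → Ω → (Fin (n + 1) → ℂ)}

theorem integral_comp_energy {n : ℕ} {c : Fin n → ℝ≥0} {v : Ω → Fin n → ℂ}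
    (hv : HasLaw v (complexNormalDiag c) P) {g : ℝ → ℝ} (hg : Measurable g) :
    ∫ x, g (energy (v x)) ∂P = ∫ z, g (energy z) ∂(complexNormalDiag c) :=
  hv.integral_comp (hg.comp measurable_energy).aestronglyMeasurable

theorem memLp_energy_comp {n : ℕ} {c : Fin n → ℝ≥0} {v : Ω → Fin n → ℂ}
    (hv : HasLaw v (complexNormalDiag c) P) (p : ℝ≥0) :
    MemLp (fun x => energy (v x)) p P := by
  have h := memLp_energy c p
  rw [← hv.map_eq] at h
  exact h.comp_of_map hv.aemeasurable

theorem integrable_energy_comp_pow {n : ℕ} {c : Fin n → ℝ≥0} {v : Ω → Fin n → ℂ}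
    (hv : HasLaw v (complexNormalDiag c) P) (k : ℕ) :
    Integrable (fun x => energy (v x) ^ k) P := by
  have h := integrable_energy_pow c k
  rw [← hv.map_eq] at h
  exact h.comp_aemeasurable hv.aemeasurable

theorem memLp_energy_comp_div_pow {n : ℕ} {c : Fin n → ℝ≥0} {v : Ω → Fin n → ℂ}
    (hv : HasLaw v (complexNormalDiag c) P) (r : ℝ) (k : ℕ) :
    MemLp (fun x => (energy (v x) / r) ^ k) 2 P := by
  have hm : AEMeasurable (fun x => energy (v x)) P :=
    measurable_energy.comp_aemeasurable hv.aemeasurable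
  rw [memLp_two_iff_integrable_sq ((hm.div_const r).pow_const k).aestronglyMeasurable]
  refine ((integrable_energy_comp_pow hv (k * 2)).div_const (r ^ (k * 2))).congr
    (ae_of_all _ fun x => ?_)
  simp only [← pow_mul, div_pow]

theorem tendsto_integral_energy_div_sub_sq [IsProbabilityMeasure P]
    (hbdd : ∀ i, (lam i : ℝ) < lamMax)
    (hmean : Tendsto (fun n : ℕ => (∑ i ∈ Finset.range n, (lam i : ℝ)) / (n : ℝ)) atTop (𝓝 lamBar))
    (hv : ∀ n, HasLaw (v n) (complexNormalDiag fun i : Fin (n + 1) => lam i) P) :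
    Tendsto (fun n => ∫ x, (energy (v n x) / ((n + 1 : ℕ) : ℝ) - lamBar) ^ 2 ∂P) atTop (𝓝 0) := by
  set V := Var[Complex.normSq; complexNormal 1]
  have hV : 0 ≤ V := variance_nonneg _ _
  have h1 := (hmean.comp (tendsto_add_atTop_nat 1))
  have hsum : ∀ n : ℕ, ∑ i : Fin (n + 1), (lam i : ℝ) = ∑ i ∈ Finset.range (n + 1), (lam i : ℝ) :=
    fun n => (Finset.sum_range fun i => (lam i : ℝ)).symm
  have hE : ∀ n, ∫ x, energy (v n x) ∂P = ∑ i ∈ Finset.range (n + 1), (lam i : ℝ) := fun n => by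
    rw [integral_comp_energy (hv n) (g := fun y => y) measurable_id, ← hsum]
    exact integral_energy _
  have hVar : ∀ n, Var[fun x => energy (v n x); P] ≤ (n + 1 : ℕ) * lamMax ^ 2 * V := fun n => by
    have : Var[fun x => energy (v n x); P] =
        Var[energy; complexNormalDiag fun i : Fin (n + 1) => lam i] := by
      rw [← (hv n).map_eq, variance_map measurable_energy.aemeasurable (hv n).aemeasurable]
      rfl
    rw [this, variance_energy]
    gcongr
    calc ∑ i : Fin (n + 1), (lam i : ℝ) ^ 2 ≤ ∑ _i : Fin (n + 1), lamMax ^ 2 := by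
          gcongr with i _
          exact (hbdd i).le
      _ = _ := by simp
  -- Variance plus squared bias.
  have hdec : ∀ n, ∫ x, (energy (v n x) / ((n + 1 : ℕ) : ℝ) - lamBar) ^ 2 ∂P =
      Var[fun x => energy (v n x); P] / ((n + 1 : ℕ) : ℝ) ^ 2 +
        ((∑ i ∈ Finset.range (n + 1), (lam i : ℝ)) / ((n + 1 : ℕ) : ℝ) - lamBar) ^ 2 := fun n => by
    have i1 : Integrable (fun x => energy (v n x)) P := by
      simpa using integrable_energy_comp_pow (hv n) 1
    have i2 := integrable_energy_comp_pow (hv n) 2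
    rw [variance_eq_sub (memLp_energy_comp (hv n) 2)]
    simp only [Pi.pow_apply]
    have e : ∀ x, (energy (v n x) / ((n + 1 : ℕ) : ℝ) - lamBar) ^ 2 =
      (energy (v n x) ^ 2 / ((n + 1 : ℕ) : ℝ) ^ 2
        - 2 * lamBar / ((n + 1 : ℕ) : ℝ) * energy (v n x)) + lamBar ^ 2 := fun x => by ring
    simp only [e]
    rw [integral_add (by exact (i2.div_const _).sub (i1.const_mul _)) (integrable_const _),
      integral_sub (i2.div_const _) (i1.const_mul _), integral_const_mul, integral_div, hE]
    simp only [integral_const, probReal_univ, one_smul]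
    ring
  have hlim : Tendsto (fun n : ℕ => lamMax ^ 2 * V * (1 / ((n : ℝ) + 1)) +
      ((∑ i ∈ Finset.range (n + 1), (lam i : ℝ)) / ((n + 1 : ℕ) : ℝ) - lamBar) ^ 2)
      atTop (𝓝 0) := by
    simpa using (tendsto_one_div_add_atTop_nhds_zero_nat.const_mul (lamMax ^ 2 * V)).add
      ((h1.sub_const lamBar).pow 2)
  refine squeeze_zero (fun n => integral_nonneg fun x => sq_nonneg _) (fun n => ?_) hlim
  rw [hdec]
  gcongr
  rw [div_le_iff₀ (by positivity)]
  refine (hVar n).trans (le_of_eq ?_)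
  push_cast
  field_simp

theorem tendsto_integral_abs_energy_div_sub [IsProbabilityMeasure P]
    (hbdd : ∀ i, (lam i : ℝ) < lamMax)
    (hmean : Tendsto (fun n : ℕ => (∑ i ∈ Finset.range n, (lam i : ℝ)) / (n : ℝ)) atTop (𝓝 lamBar))
    (hv : ∀ n, HasLaw (v n) (complexNormalDiag fun i : Fin (n + 1) => lam i) P) :
    Tendsto (fun n => ∫ x, |energy (v n x) / ((n + 1 : ℕ) : ℝ) - lamBar| ∂P) atTop (𝓝 0) := by
  have hlim := (tendsto_integral_energy_div_sub_sq hbdd hmean hv).sqrt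
  rw [Real.sqrt_zero] at hlim
  refine squeeze_zero (fun n => integral_nonneg fun x => abs_nonneg _) (fun n => ?_) hlim
  have h := memLp_energy_comp_div_pow (hv n) ((n + 1 : ℕ) : ℝ) 1
  simp only [pow_one] at h
  exact integral_abs_le_sqrt (f := fun x => energy (v n x) / ((n + 1 : ℕ) : ℝ) - lamBar)
    (h.sub (memLp_const lamBar))

theorem tendsto_integral_energy_div_pow [IsProbabilityMeasure P]
    (hbdd : ∀ i, (lam i : ℝ) < lamMax)
    (hmean : Tendsto (fun n : ℕ => (∑ i ∈ Finset.range n, (lam i : ℝ)) / (n : ℝ)) atTop (𝓝 lamBar))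
    (hv : ∀ n, HasLaw (v n) (complexNormalDiag fun i : Fin (n + 1) => lam i) P) (k : ℕ) :
    Tendsto (fun n => ∫ x, (energy (v n x) / ((n + 1 : ℕ) : ℝ)) ^ k ∂P) atTop
      (𝓝 (lamBar ^ k)) := by
  refine tendsto_integral_pow_of_tendsto_sq
    (fun n k => memLp_energy_comp_div_pow (hv n) _ k) (fun k => ?_)
    (tendsto_integral_energy_div_sub_sq hbdd hmean hv) k
  rcases k with _ | k
  · exact ⟨1, fun n => by simp⟩
  · refine ⟨lamMax ^ (k + 1) * ∫ z, Complex.normSq z ^ (k + 1) ∂(complexNormal 1), fun n => ?_⟩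
    simp only [div_pow]
    rw [integral_div, div_le_iff₀ (by positivity),
      integral_comp_energy (hv n) (g := fun y => y ^ (k + 1)) (by fun_prop)]
    refine (integral_energy_pow_succ_le _ (fun i => (hbdd i).le) k).trans (le_of_eq ?_)
    ring

end Concentration

/-! ### Cumulants from moments -/

section Cumulants

variable {Ω : Type*} [MeasurableSpace Ω] {P : Measure Ω} [IsProbabilityMeasure P]

theorem deriv_mgf_eventuallyEq {X : Ω → ℝ} (h : 0 ∈ interior (integrableExpSet X P)) :
    deriv (mgf X P) =ᶠ[𝓝 0] mgf X P * deriv (cgf X P) := by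
  filter_upwards [isOpen_interior.mem_nhds h] with t ht
  rw [Pi.mul_apply, deriv_cgf ht, deriv_mgf ht, mul_div_cancel₀]
  exact (mgf_pos (interior_subset (s := integrableExpSet X P) ht)).ne'

/-- The recursion that expresses cumulants through moments. -/
theorem cumulant_succ {X : Ω → ℝ} (h : 0 ∈ interior (integrableExpSet X P)) (k : ℕ) :
    cumulant X P (k + 1) = ∫ x, X x ^ (k + 1) ∂P -
      ∑ j ∈ Finset.range k, (k.choose (j + 1) : ℝ) * (∫ x, X x ^ (j + 1) ∂P) *
        cumulant X P (k - (j + 1) + 1) := by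
  have hmgf : ∀ i, iteratedDeriv i (mgf X P) 0 = ∫ x, X x ^ i ∂P :=
    fun i => iteratedDeriv_mgf_zero h i
  have hrec := hmgf (k + 1)
  -- Leibniz's rule for `M' = M K'`, with `M` the moment generating function and `K = log M`. The
  -- split-off term of index `0` is the top cumulant, because `M 0 = 1`.
  rw [iteratedDeriv_succ', (deriv_mgf_eventuallyEq h).iteratedDeriv_eq,
    iteratedDeriv_mul (analyticAt_mgf h).contDiffAt (analyticAt_cgf h).deriv.contDiffAt,
    Finset.sum_range_succ'] at hrec
  simp only [hmgf, ← iteratedDeriv_succ'] at hrec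
  simp only [cumulant, ← hrec]
  simp

/-- In the recursion, the moment of order `j + 1` grows at most like `N^j` and its partner cumulant
like `N^(k-j-1)`; a factor `1/N` is left over and kills the sum. -/
theorem tendsto_cumulant_succ_div_pow {X : ℕ → Ω → ℝ} {a : ℝ}
    (h : ∀ n, 0 ∈ interior (integrableExpSet (X n) P))
    (hm : ∀ k, Tendsto (fun n => (∫ x, X n x ^ (k + 1) ∂P) / ((n + 1 : ℕ) : ℝ) ^ k) atTop
      (𝓝 (a ^ (k + 1)))) (k : ℕ) :
    Tendsto (fun n => cumulant (X n) P (k + 1) / ((n + 1 : ℕ) : ℝ) ^ k) atTop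
      (𝓝 (a ^ (k + 1))) := by
  induction k using Nat.strong_induction_on with
  | _ k ih =>
    have hsum : Tendsto (fun n => ∑ j ∈ Finset.range k,
        (k.choose (j + 1) : ℝ) * ((∫ x, X n x ^ (j + 1) ∂P) / ((n + 1 : ℕ) : ℝ) ^ j) *
          (cumulant (X n) P (k - (j + 1) + 1) / ((n + 1 : ℕ) : ℝ) ^ (k - (j + 1))) *
          (1 / ((n : ℝ) + 1))) atTop (𝓝 0) := by
      rw [← Finset.sum_const_zero (s := Finset.range k)]
      refine tendsto_finsetSum _ fun j hj => ?_
      have hj' := Finset.mem_range.1 hj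
      simpa using (((hm j).const_mul (k.choose (j + 1) : ℝ)).mul
        (ih (k - (j + 1)) (by omega))).mul tendsto_one_div_add_atTop_nhds_zero_nat
    have hlim := (hm k).sub hsum
    rw [sub_zero] at hlim
    refine hlim.congr fun n => ?_
    rw [cumulant_succ (h n), sub_div, Finset.sum_div]
    congr 1
    refine Finset.sum_congr rfl fun j hj => ?_
    have hk : k = j + (k - (j + 1)) + 1 := by have := Finset.mem_range.1 hj; omega
    have hpow : ((n + 1 : ℕ) : ℝ) ^ k =
        ((n + 1 : ℕ) : ℝ) ^ j * ((n + 1 : ℕ) : ℝ) ^ (k - (j + 1)) * ((n : ℝ) + 1) := by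
      conv_lhs => rw [hk, pow_succ, pow_add]
      push_cast
      ring
    rw [hpow]
    field_simp

theorem coeff_C_mul_inv_one_sub (a : ℝ) (k : ℕ) :
    PowerSeries.coeff k (PowerSeries.C a * (1 - PowerSeries.X * PowerSeries.C a)⁻¹) =
      a ^ (k + 1) := by
  have h : (1 - PowerSeries.X * PowerSeries.C a)⁻¹ = PowerSeries.mk fun k => a ^ k := by
    rw [eq_comm, PowerSeries.eq_inv_iff_mul_eq_one (by simp)]
    ext k
    rw [mul_sub, mul_one, ← mul_assoc, map_sub, PowerSeries.coeff_mul_C, PowerSeries.coeff_mk,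
      PowerSeries.coeff_one]
    rcases k with _ | k
    · simp
    · simp [PowerSeries.coeff_succ_mul_X, pow_succ]
  rw [h, PowerSeries.coeff_C_mul, PowerSeries.coeff_mk, pow_succ']

end Cumulants

/-! ### Limit of the cumulant series -/

section CumulantLimit

variable {Ω : Type*} [MeasurableSpace Ω] {P : Measure Ω} [IsProbabilityMeasure P]
  {lam : ℕ → ℝ≥0} {lamMax lamBar : ℝ}
  {v : (n : ℕ) → Ω → (Fin (n + 1) → ℂ)} {J : (n : ℕ) → Ω → Fin (n + 1)}

/-- The mixture weight `1/N` supplies the missing power of `N`, and the atom at `0` has no positive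
moments. -/
theorem tendsto_integral_selectedEigenvalue_pow_div
    (hbdd : ∀ i, (lam i : ℝ) < lamMax)
    (hmean : Tendsto (fun n : ℕ => (∑ i ∈ Finset.range n, (lam i : ℝ)) / (n : ℝ)) atTop (𝓝 lamBar))
    (hv : ∀ n, HasLaw (v n) (complexNormalDiag fun i : Fin (n + 1) => lam i) P)
    (hJ : ∀ n, HasLaw (J n) (uniformOn Set.univ) P) (hindep : ∀ n, IndepFun (v n) (J n) P)
    (k : ℕ) :
    Tendsto (fun n => (∫ x, selectedEigenvalue (v n) (J n) x ^ (k + 1) ∂P) /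
      ((n + 1 : ℕ) : ℝ) ^ k) atTop (𝓝 (lamBar ^ (k + 1))) := by
  refine (tendsto_integral_energy_div_pow hbdd hmean hv (k + 1)).congr fun n => ?_
  rw [(integral_comp_selectedEigenvalue (hJ n) (hindep n) (g := fun y => y ^ (k + 1))
    (by fun_prop) (integrable_energy_comp_pow (hv n) (k + 1))).2]
  simp only [div_pow, integral_div]
  have : ((n + 1 : ℕ) : ℝ) ≠ 0 := by positivity
  field_simp
  simp
  ring

theorem tendsto_rescale_rSeries_selectedEigenvalue
    (hbdd : ∀ i, (lam i : ℝ) < lamMax)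
    (hmean : Tendsto (fun n : ℕ => (∑ i ∈ Finset.range n, (lam i : ℝ)) / (n : ℝ)) atTop (𝓝 lamBar))
    (hv : ∀ n, HasLaw (v n) (complexNormalDiag fun i : Fin (n + 1) => lam i) P)
    (hJ : ∀ n, HasLaw (J n) (uniformOn Set.univ) P) (hindep : ∀ n, IndepFun (v n) (J n) P) :
    Tendsto
      (fun n : ℕ => PowerSeries.rescale (1 / ((n + 1 : ℕ) : ℝ))
        (rSeries (selectedEigenvalue (v n) (J n)) P))
      atTop
      (𝓝 (PowerSeries.C lamBar * (1 - PowerSeries.X * PowerSeries.C lamBar)⁻¹)) := by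
  rw [PowerSeries.WithPiTopology.tendsto_iff_coeff_tendsto]
  intro k
  rw [coeff_C_mul_inv_one_sub]
  refine (tendsto_cumulant_succ_div_pow
    (fun n => zero_mem_interior_integrableExpSet_selectedEigenvalue (hv n) (hJ n) (hindep n))
    (tendsto_integral_selectedEigenvalue_pow_div hbdd hmean hv hJ hindep) k).congr fun n => ?_
  rw [PowerSeries.coeff_rescale, rSeries, PowerSeries.coeff_mk, one_div, inv_pow, div_eq_inv_mul]

end CumulantLimit

/-! ### Stieltjes transforms on the negative half line -/

section Stieltjes

variable {Ω : Type*} [MeasurableSpace Ω] {P : Measure Ω} {Y : Ω → ℝ}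

theorem stieltjes_nonneg (hY : 0 ≤ Y) {z : ℝ} (hz : z < 0) : 0 ≤ stieltjes Y P z :=
  integral_nonneg fun x => one_div_nonneg.2 (by linarith [show 0 ≤ Y x from hY x])

variable [IsProbabilityMeasure P]

theorem one_div_sub_le_one_div_neg {y z w : ℝ} (hy : 0 ≤ y) (hw : w < 0) (hz : z ≤ w) :
    1 / (y - z) ≤ 1 / -w :=
  one_div_le_one_div_of_le (neg_pos.2 hw) (by linarith)

theorem integrable_one_div_sub (hY : 0 ≤ Y) (hm : AEMeasurable Y P) {z : ℝ} (hz : z < 0) :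
    Integrable (fun x => 1 / (Y x - z)) P := by
  refine Integrable.of_bound ((hm.sub_const z).const_div 1).aestronglyMeasurable (1 / -z)
    (ae_of_all _ fun x => ?_)
  rw [Real.norm_of_nonneg (one_div_nonneg.2 (by linarith [show 0 ≤ Y x from hY x]))]
  exact one_div_sub_le_one_div_neg (hY x) hz le_rfl

theorem stieltjes_le (hY : 0 ≤ Y) (hm : AEMeasurable Y P) {z : ℝ} (hz : z < 0) :
    stieltjes Y P z ≤ 1 / -z := by
  have h := integral_mono (integrable_one_div_sub hY hm hz) (integrable_const (1 / -z))
    fun x => one_div_sub_le_one_div_neg (hY x) hz le_rfl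
  rwa [integral_const, probReal_univ, one_smul] at h

theorem monotoneOn_stieltjes (hY : 0 ≤ Y) (hm : AEMeasurable Y P) :
    MonotoneOn (stieltjes Y P) (Set.Iio 0) := fun z hz w hw hzw =>
  integral_mono (integrable_one_div_sub hY hm hz) (integrable_one_div_sub hY hm hw) fun x =>
    one_div_le_one_div_of_le (by linarith [show 0 ≤ Y x from hY x, Set.mem_Iio.1 hw]) (by linarith)

theorem continuousOn_stieltjes (hY : 0 ≤ Y) (hm : AEMeasurable Y P) {w : ℝ} (hw : w < 0) :
    ContinuousOn (stieltjes Y P) (Set.Iic w) := by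
  have hpos : ∀ x, ∀ z ∈ Set.Iic w, 0 < Y x - z := fun x z hz => by
    linarith [show 0 ≤ Y x from hY x, Set.mem_Iic.1 hz]
  refine continuousOn_of_dominated (bound := fun _ => 1 / -w) (fun z hz => ?_) (fun z hz => ?_)
    (integrable_const _) (ae_of_all _ fun x => ?_)
  · exact ((hm.sub_const z).const_div 1).aestronglyMeasurable
  · refine ae_of_all _ fun x => ?_
    rw [Real.norm_of_nonneg (one_div_pos.2 (hpos x z hz)).le]
    exact one_div_sub_le_one_div_neg (hY x) hw hz
  · exact continuousOn_const.div (by fun_prop) fun z hz => (hpos x z hz).ne'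

/-- If `G` is a mixture of a Stieltjes transform of a nonnegative random variable and the Stieltjes
transform of the Dirac mass at `0`, the latter with positive weight, then it is a bijection from the
negative onto the positive half line. -/
theorem bijOn_stieltjes_mixture (hY : 0 ≤ Y) (hm : AEMeasurable Y P) {G : ℝ → ℝ} {p : ℝ}
    (hp0 : 0 ≤ p) (hp1 : p < 1)
    (hG : ∀ z < 0, G z = p * stieltjes Y P z + (1 - p) * (1 / -z)) :
    Set.BijOn G (Set.Iio 0) (Set.Ioi 0) := by
  have hq : 0 < 1 - p := sub_pos.2 hp1
  have hlow : ∀ z < 0, (1 - p) * (1 / -z) ≤ G z := fun z hz => by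
    rw [hG z hz]
    exact le_add_of_nonneg_left (mul_nonneg hp0 (stieltjes_nonneg hY hz))
  have hupp : ∀ z < 0, G z ≤ 1 / -z := fun z hz => by
    rw [hG z hz]
    nlinarith [mul_le_mul_of_nonneg_left (stieltjes_le (P := P) hY hm hz) hp0]
  have hmono : StrictMonoOn G (Set.Iio 0) := fun z hz w hw hzw => by
    rw [hG z hz, hG w hw]
    exact add_lt_add_of_le_of_lt
      (mul_le_mul_of_nonneg_left (monotoneOn_stieltjes hY hm hz hw hzw.le) hp0)
      (mul_lt_mul_of_pos_left (one_div_lt_one_div_of_lt (neg_pos.2 hw) (neg_lt_neg hzw)) hq)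
  refine ⟨fun z hz => ?_, hmono.injOn, fun t ht => ?_⟩
  · exact (mul_pos hq (one_div_pos.2 (neg_pos.2 hz))).trans_le (hlow z hz)
  · have ht : 0 < t := ht
    -- The bounds `(1 - p)/(-z) ≤ G z ≤ 1/(-z)` equal `t` at these two endpoints, which therefore
    -- bracket the preimage.
    have h1 : -(1 / t) < 0 := neg_lt_zero.2 (one_div_pos.2 ht)
    have h2 : -((1 - p) / t) < 0 := neg_lt_zero.2 (div_pos hq ht)
    have h12 : -(1 / t) ≤ -((1 - p) / t) := by gcongr; linarith
    have hc : ContinuousOn G (Set.Icc (-(1 / t)) (-((1 - p) / t))) := by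
      refine ContinuousOn.congr (f := fun z => p * stieltjes Y P z + (1 - p) * (1 / -z)) ?_
        fun z hz => hG z (hz.2.trans_lt h2)
      refine (continuousOn_const.mul ((continuousOn_stieltjes hY hm h2).mono fun z hz => hz.2)).add
        (continuousOn_const.mul (continuousOn_const.div continuousOn_neg fun z hz => ?_))
      exact (neg_pos.2 (hz.2.trans_lt h2)).ne'
    have hmem : t ∈ Set.Icc (G (-(1 / t))) (G (-((1 - p) / t))) := by
      constructor
      · simpa using hupp _ h1
      · refine le_trans (le_of_eq ?_) (hlow _ h2)
        field_simp
    obtain ⟨z, hz, rfl⟩ := intermediate_value_Icc h12 hc hmem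
    exact ⟨z, hz.2.trans_lt h2, rfl⟩

theorem abs_one_div_add_sub_one_div_add_le {w a y : ℝ} (hw : 0 ≤ w) (ha : 0 ≤ a) (hy : 0 < y) :
    |1 / (w + y) - 1 / (a + y)| ≤ |w - a| * (1 / y ^ 2) := by
  have h1 : 0 < w + y := by positivity
  have h2 : 0 < a + y := by positivity
  rw [div_sub_div _ _ h1.ne' h2.ne', abs_div, abs_of_pos (mul_pos h1 h2), ← div_eq_mul_one_div,
    show 1 * (a + y) - (w + y) * 1 = a - w by ring, abs_sub_comm]
  gcongr
  nlinarith

/-- For `y > 0`, the map `w ↦ 1/(w + y)` is Lipschitz on `w ≥ 0` with constant `1/y²`, so `L¹`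
convergence suffices even for moving `y n`. -/
theorem tendsto_integral_one_div_add {W : ℕ → Ω → ℝ} {a b : ℝ} {y : ℕ → ℝ}
    (hW : ∀ n, 0 ≤ W n) (hi : ∀ n, Integrable (W n) P) (ha : 0 ≤ a) (hb : 0 < b)
    (hW1 : Tendsto (fun n => ∫ x, |W n x - a| ∂P) atTop (𝓝 0))
    (hy : Tendsto y atTop (𝓝 b)) :
    Tendsto (fun n => ∫ x, 1 / (W n x + y n) ∂P) atTop (𝓝 (1 / (a + b))) := by
  have h1 : Tendsto (fun n => 1 / (a + y n)) atTop (𝓝 (1 / (a + b))) :=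
    tendsto_const_nhds.div (hy.const_add a) (by positivity)
  have h2 : Tendsto (fun n => (∫ x, |W n x - a| ∂P) * (1 / y n ^ 2)) atTop (𝓝 0) := by
    simpa using hW1.mul (tendsto_const_nhds.div (hy.pow 2) (by positivity) (a := (1 : ℝ)))
  have h3 : Tendsto (fun n => ∫ x, 1 / (W n x + y n) ∂P - 1 / (a + y n)) atTop (𝓝 0) := by
    refine squeeze_zero_norm' ?_ h2
    filter_upwards [hy.eventually (lt_mem_nhds hb)] with n hn
    have hint : Integrable (fun x => 1 / (W n x + y n)) P := by
      simpa using integrable_one_div_sub (hW n) (hi n).aemeasurable (neg_lt_zero.2 hn)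
    have e : ∫ x, 1 / (W n x + y n) ∂P - 1 / (a + y n) =
        ∫ x, (1 / (W n x + y n) - 1 / (a + y n)) ∂P := by
      rw [integral_sub hint (integrable_const _), integral_const, probReal_univ, one_smul]
    rw [e, Real.norm_eq_abs, ← integral_mul_const]
    refine abs_integral_le_integral_abs.trans (integral_mono
      (hint.sub (integrable_const _)).abs (((hi n).sub (integrable_const a)).abs.mul_const _)
      fun x => abs_one_div_add_sub_one_div_add_le (hW n x) ha hn)
  simpa using h3.add h1

end Stieltjes

/-! ### Limit of the inverse Stieltjes transform -/

section StieltjesLimit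

variable {Ω : Type*} [MeasurableSpace Ω] {P : Measure Ω} [IsProbabilityMeasure P]
  {lam : ℕ → ℝ≥0} {lamMax lamBar : ℝ}

theorem stieltjes_selectedEigenvalue {n : ℕ} {c : Fin (n + 1) → ℝ≥0}
    {v : Ω → Fin (n + 1) → ℂ} (hv : HasLaw v (complexNormalDiag c) P) {J : Ω → Fin (n + 1)}
    (hJ : HasLaw J (uniformOn Set.univ) P) (hind : IndepFun v J P) {z : ℝ} (hz : z < 0) :
    stieltjes (selectedEigenvalue v J) P z =
      1 / ((n + 1 : ℕ) : ℝ) * stieltjes (fun x => energy (v x)) P z +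
        (1 - 1 / ((n + 1 : ℕ) : ℝ)) * (1 / -z) := by
  have h := (integral_comp_selectedEigenvalue hJ hind (g := fun y => 1 / (y - z)) (by fun_prop)
    (integrable_one_div_sub (fun x => energy_nonneg (v x))
      (measurable_energy.comp_aemeasurable hv.aemeasurable) hz)).2
  rwa [zero_sub] at h

/-- From dimension two on, the atom at `0` has positive weight, which makes the transform blow up at
`0`. -/
theorem bijOn_stieltjes_selectedEigenvalue {n : ℕ} (hn : 1 ≤ n) {c : Fin (n + 1) → ℝ≥0}
    {v : Ω → Fin (n + 1) → ℂ} (hv : HasLaw v (complexNormalDiag c) P) {J : Ω → Fin (n + 1)}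
    (hJ : HasLaw J (uniformOn Set.univ) P) (hind : IndepFun v J P) :
    Set.BijOn (stieltjes (selectedEigenvalue v J) P) (Set.Iio 0) (Set.Ioi 0) := by
  refine bijOn_stieltjes_mixture (P := P) (fun x => energy_nonneg (v x))
    (measurable_energy.comp_aemeasurable hv.aemeasurable) (p := 1 / ((n + 1 : ℕ) : ℝ))
    (by positivity) ?_ fun z hz => stieltjes_selectedEigenvalue hv hJ hind hz
  rw [div_lt_one (by positivity)]
  exact_mod_cast Nat.lt_succ_of_le hn

theorem exists_rTransform_selectedEigenvalue_eq {n : ℕ} (hn : 1 ≤ n) {c : Fin (n + 1) → ℝ≥0}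
    {v : Ω → Fin (n + 1) → ℂ} (hv : HasLaw v (complexNormalDiag c) P) {J : Ω → Fin (n + 1)}
    (hJ : HasLaw J (uniformOn Set.univ) P) (hind : IndepFun v J P) {t : ℝ} (ht : 0 < t) :
    ∃ y : ℝ, (1 - 1 / ((n + 1 : ℕ) : ℝ)) * (1 / t) ≤ y ∧ y ≤ 1 / t ∧
      rTransform (selectedEigenvalue v J) P (-t / ((n + 1 : ℕ) : ℝ)) =
        (1 - y * ∫ x, 1 / (energy (v x) / ((n + 1 : ℕ) : ℝ) + y) ∂P) / t := by
  set N : ℝ := ((n + 1 : ℕ) : ℝ) with hN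
  have hN0 : 0 < N := by positivity
  set z := stieltjesInv (selectedEigenvalue v J) P (-(-t / N)) with hzdef
  have hsurj := (bijOn_stieltjes_selectedEigenvalue hn hv hJ hind).surjOn
  have htN : -(-t / N) ∈ Set.Ioi (0 : ℝ) := by
    rw [neg_div, neg_neg]
    exact div_pos ht hN0
  have hz : z < 0 := Function.invFunOn_mem (hsurj htN)
  have hGz : stieltjes (selectedEigenvalue v J) P z = -(-t / N) :=
    Function.invFunOn_eq (hsurj htN)
  set y := -z / N with hydef
  have hy : 0 < y := div_pos (neg_pos.2 hz) hN0
  have hzy : z = -(N * y) := by rw [hydef]; field_simp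
  set I := ∫ x, 1 / (energy (v x) / N + y) ∂P with hI
  have hm : AEMeasurable (fun x => energy (v x) / N) P :=
    (measurable_energy.comp_aemeasurable hv.aemeasurable).div_const N
  have hnn : 0 ≤ fun x => energy (v x) / N := fun x => div_nonneg (energy_nonneg _) hN0.le
  have hIs : I = stieltjes (fun x => energy (v x) / N) P (-y) := by
    simp only [hI, stieltjes, sub_neg_eq_add]
  have hI0 : 0 ≤ I := hIs ▸ stieltjes_nonneg hnn (neg_lt_zero.2 hy)
  have hI1 : I * y ≤ 1 := by
    have := stieltjes_le (P := P) hnn hm (neg_lt_zero.2 hy)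
    rwa [← hIs, neg_neg, le_div_iff₀ hy] at this
  have hS : stieltjes (fun x => energy (v x)) P z = I / N := by
    rw [hI, ← integral_div, stieltjes]
    refine integral_congr_ae (ae_of_all _ fun x => ?_)
    have : 0 < energy (v x) + N * y := add_pos_of_nonneg_of_pos (energy_nonneg _) (by positivity)
    simp only [hzy, sub_neg_eq_add]
    field_simp
  -- The equation `G z = t / N` with denominators cleared. The bounds on `y` follow from `0 ≤ y * I
  -- ≤ 1`.
  have hrel : N * (1 - t * y) = 1 - y * I := by
    have h := stieltjes_selectedEigenvalue hv hJ hind hz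
    rw [hGz, hS, ← hN, hzy] at h
    field_simp at h
    linarith
  have hty : t * y = 1 - (1 - y * I) / N := by
    rw [← hrel]
    field_simp
    ring
  refine ⟨y, ?_, ?_, ?_⟩
  · rw [mul_one_div, div_le_iff₀ ht, mul_comm y, hty]
    gcongr
    nlinarith
  · rw [le_div_iff₀ ht, mul_comm y, hty]
    exact sub_le_self _ (div_nonneg (by nlinarith) hN0.le)
  · rw [rTransform, ← hzdef, ← hrel, hzy]
    field_simp
    ring

theorem tendsto_rTransform_selectedEigenvalue
    {v : (n : ℕ) → Ω → (Fin (n + 1) → ℂ)} {J : (n : ℕ) → Ω → Fin (n + 1)}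
    (hbdd : ∀ i, (lam i : ℝ) < lamMax)
    (hmean : Tendsto (fun n : ℕ => (∑ i ∈ Finset.range n, (lam i : ℝ)) / (n : ℝ)) atTop (𝓝 lamBar))
    (hv : ∀ n, HasLaw (v n) (complexNormalDiag fun i : Fin (n + 1) => lam i) P)
    (hJ : ∀ n, HasLaw (J n) (uniformOn Set.univ) P) (hindep : ∀ n, IndepFun (v n) (J n) P)
    {s : ℝ} (hs : s < 0) :
    Tendsto
      (fun n : ℕ => rTransform (selectedEigenvalue (v n) (J n)) P (s / ((n + 1 : ℕ) : ℝ)))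
      atTop (𝓝 (lamBar / (1 - s * lamBar))) := by
  have ha : 0 ≤ lamBar := ge_of_tendsto' hmean fun n => by positivity
  obtain ⟨t, rfl⟩ : ∃ t, s = -t := ⟨-s, (neg_neg s).symm⟩
  have ht : 0 < t := neg_lt_zero.1 hs
  have hex : ∀ n : ℕ, ∃ y : ℝ, 1 ≤ n → (1 - 1 / ((n + 1 : ℕ) : ℝ)) * (1 / t) ≤ y ∧ y ≤ 1 / t ∧
      rTransform (selectedEigenvalue (v n) (J n)) P (-t / ((n + 1 : ℕ) : ℝ)) =
        (1 - y * ∫ x, 1 / (energy (v n x) / ((n + 1 : ℕ) : ℝ) + y) ∂P) / t := fun n => by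
    by_cases hn : 1 ≤ n
    · obtain ⟨y, hy⟩ := exists_rTransform_selectedEigenvalue_eq hn (hv n) (hJ n) (hindep n) ht
      exact ⟨y, fun _ => hy⟩
    · exact ⟨0, fun h => absurd h hn⟩
  choose y hy using hex
  have hylim : Tendsto y atTop (𝓝 (1 / t)) := by
    have hlow : Tendsto (fun n : ℕ => (1 - 1 / ((n + 1 : ℕ) : ℝ)) * (1 / t)) atTop (𝓝 (1 / t)) := by
      have h := (tendsto_one_div_add_atTop_nhds_zero_nat (𝕜 := ℝ)).const_sub 1
      simpa using h.mul_const (1 / t)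
    refine tendsto_of_tendsto_of_tendsto_of_le_of_le' hlow tendsto_const_nhds ?_ ?_
    · filter_upwards [eventually_ge_atTop 1] with n hn using (hy n hn).1
    · filter_upwards [eventually_ge_atTop 1] with n hn using (hy n hn).2.1
  have hI := tendsto_integral_one_div_add (P := P)
    (W := fun n x => energy (v n x) / ((n + 1 : ℕ) : ℝ))
    (fun n x => div_nonneg (energy_nonneg _) (by positivity))
    (fun n => by simpa using (integrable_energy_comp_pow (hv n) 1).div_const ((n + 1 : ℕ) : ℝ))
    ha (one_div_pos.2 ht) (tendsto_integral_abs_energy_div_sub hbdd hmean hv) hylim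
  have hlim := ((hylim.mul hI).const_sub 1).div_const t
  have e : (1 - 1 / t * (1 / (lamBar + 1 / t))) / t = lamBar / (1 - -t * lamBar) := by
    have h1 : 0 < lamBar * t + 1 := by positivity
    have h2 : 1 - -t * lamBar = lamBar * t + 1 := by ring
    rw [h2]
    field_simp
    ring
  rw [e] at hlim
  refine hlim.congr' ?_
  filter_upwards [eventually_ge_atTop 1] with n hn using (hy n hn).2.2.symm

end StieltjesLimit

end

theorem theorem1 {Ω : Type*} [MeasurableSpace Ω] (P : Measure Ω) [IsProbabilityMeasure P]
    (lam : ℕ → ℝ≥0) (lamMax lamBar : ℝ)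
    (hbdd : ∀ i, (lam i : ℝ) < lamMax)
    (hmean : Tendsto (fun n : ℕ => (∑ i ∈ Finset.range n, (lam i : ℝ)) / (n : ℝ)) atTop (𝓝 lamBar))
    -- the random vector in dimension `n + 1` and the position of the selected eigenvalue
    (v : (n : ℕ) → Ω → (Fin (n + 1) → ℂ))
    (hv : ∀ n, HasLaw (v n) (complexNormalDiag fun i : Fin (n + 1) => lam i) P)
    (J : (n : ℕ) → Ω → Fin (n + 1))
    (hJ : ∀ n, HasLaw (J n) (uniformOn Set.univ) P)
    (hindep : ∀ n, IndepFun (v n) (J n) P) :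
    -- the moment generating function is finite around `0`, so that the cumulants are defined
    (∀ n, (0 : ℝ) ∈ interior (integrableExpSet (selectedEigenvalue (v n) (J n)) P)) ∧
    -- cumulant series: coefficientwise convergence of formal power series in `s`
    Tendsto
      (fun n : ℕ => PowerSeries.rescale (1 / ((n + 1 : ℕ) : ℝ))
        (rSeries (selectedEigenvalue (v n) (J n)) P))
      atTop
      (𝓝 (PowerSeries.C lamBar * (1 - PowerSeries.X * PowerSeries.C lamBar)⁻¹)) ∧
    -- inverse Stieltjes transform: it is well defined, and there is pointwise convergence
    (∀ᶠ n : ℕ in atTop,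
      Set.BijOn (stieltjes (selectedEigenvalue (v n) (J n)) P) (Set.Iio 0) (Set.Ioi 0)) ∧
    ∀ s : ℝ, s < 0 →
      Tendsto
        (fun n : ℕ => rTransform (selectedEigenvalue (v n) (J n)) P (s / ((n + 1 : ℕ) : ℝ)))
        atTop
        (𝓝 (lamBar / (1 - s * lamBar))) := by
  refine ⟨fun n => zero_mem_interior_integrableExpSet_selectedEigenvalue (hv n) (hJ n) (hindep n),
    tendsto_rescale_rSeries_selectedEigenvalue hbdd hmean hv hJ hindep, ?_,
    fun s hs => tendsto_rTransform_selectedEigenvalue hbdd hmean hv hJ hindep hs⟩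
  filter_upwards [eventually_ge_atTop 1] with n hn
  exact bijOn_stieltjes_selectedEigenvalue hn (hv n) (hJ n) (hindep n)
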